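/- **Model.** All logarithms are to base $2$. Let $[n]=\{1,\dots,n\}$. A conditional sample from a distribution $\mu$ on $[n]$ with a nonempty condition set $A\subseteq[n]$ is an element $j\in A$ drawn with probability $\mu(j)/\mu(A)$ if $\mu(A)>0$, and drawn uniformly from $A$ if $\mu(A)=0$. A (randomized) *non-adaptive algorithm taking at most $t$ conditional samples* on $[n]$ tosses its internal coins, generates from them a sequence of at most $t$ nonempty sets $A_1,A_2,\dots\subseteq[n]$, receives mutually independent conditional samples $j_1,j_2,\dots$, where $j_i$ is drawn from the unknown $\mu$ with condition set $A_i$, and then accepts or rejects on the basis of its coins and of the samples. Distance between distributions on $[n]$ is the variation distance $d(\mu,\mu')=\frac12\sum_i|\mu(i)-\mu'(i)|$. Such an algorithm is an $(\epsilon,\delta)$-*tester for uniformity* if it accepts the uniform distribution on $[n]$ with probability at least $1-\delta$ and rejects every $\mu$ at distance at least $\epsilon$ from the uniform distribution with probability at least $1-\delta$. For $n\ge 16$, the *even uniblock distribution* is the following distribution over distributions on $[n]$: choose uniformly an integer $k$ with $\frac18\log n\le k\le\frac38\log n$, then choose uniformly a set $U\subseteq[n]$ of size exactly $2^{2k}$,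 and output the uniform distribution on $U$. **Theorem.** 1. Non-adaptive testing of uniformity requires $\Omega(\log\log n)$ conditional samples for the fixed distance $\epsilon=\frac12$: for every $0<\delta<\frac12$ there is $N$ such that for all $n\ge N$ every non-adaptive $(\frac12,\delta)$-tester for uniformity on $[n]$ that takes at most $t$ conditional samples satisfies $t>\frac14\log\log n$. 2. There is a function $\rho:\mathbb N\to\mathbb R$ with $\rho(n)\to0$ such that for all $n\ge16$ every distribution that may result from the even uniblock distribution is $\frac12$-far from the uniform distribution on $[n]$, and every non-adaptive algorithm on $[n]$ taking at most $t\le\frac14\log\log n$ conditional samples satisfies $$\Bigl|\Pr[\text{accept the uniform distribution}]-\Pr_{\mu}[\text{accept }\mu]\Bigr|\le\rho(n),$$ where in the second probability $\mu$ is drawn from the even uniblock distribution (and the samples and the coins are drawn independently given $\mu$). -/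

import Mathlib

noncomputable section

namespace CondSampling

/-! ### The conditional sampling model -/

/-- A single conditional sample from `μ` with the condition set `A`: the law of `μ` conditioned on
`A` if `A` has positive weight, and the uniform law on `A` if `A` has weight zero. -/
def condSample {n : ℕ} (μ : PMF (Fin n)) (A : Finset (Fin n)) (hA : A.Nonempty) : PMF (Fin n) :=
  open Classical in
  if h : ∃ i ∈ (A : Set (Fin n)), i ∈ μ.support then μ.filter (A : Set (Fin n)) h
  else PMF.uniformOfFinset A hA

/-- Independent conditional samples `j₁, …, j_t` from `μ`, where `j_i` is a conditional sample
with the condition set `A_i`, for a list `A₁, …, A_t` of nonempty sets. -/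
def condSamples {n : ℕ} (μ : PMF (Fin n)) :
    List {A : Finset (Fin n) // A.Nonempty} → PMF (List (Fin n))
  | [] => PMF.pure []
  | A :: As => (condSample μ A.1 A.2).bind fun j => (condSamples μ As).map fun js => j :: js

/-- A randomized non-adaptive conditional sampling algorithm over a domain of size `n`.
It tosses its internal coins, generates from the coins alone a finite sequence of condition sets
(repetitions are allowed), and decides (`true` is "accept") from the coins and the samples. -/
structure NonAdaptiveAlgorithm (n : ℕ) where
  /-- The possible outcomes of the internal coins. -/
  Coins : Type
  /-- The law of the internal coins. -/
  coinLaw : PMF Coins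
  /-- The sets to be conditioned upon. -/
  sets : Coins → List {A : Finset (Fin n) // A.Nonempty}
  /-- The final decision. -/
  decision : Coins → List (Fin n) → Bool

/-- The law of the decision of the algorithm on the input distribution `μ`. -/
def NonAdaptiveAlgorithm.run {n : ℕ} (T : NonAdaptiveAlgorithm n) (μ : PMF (Fin n)) : PMF Bool :=
  T.coinLaw.bind fun c => (condSamples μ (T.sets c)).map (T.decision c)

/-- The algorithm takes at most `s` conditional samples. -/
def NonAdaptiveAlgorithm.UsesAtMost {n : ℕ} (T : NonAdaptiveAlgorithm n) (s : ℕ) : Prop :=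
  ∀ c ∈ T.coinLaw.support, (T.sets c).length ≤ s

/-- The variation distance `½ ∑ |p_i - p'_i|`. -/
def tvDist {n : ℕ} (μ ν : PMF (Fin n)) : ℝ :=
  (1 / 2) * ∑ i, |(μ i).toReal - (ν i).toReal|

/-- `μ` is `ε`-far from the property `P`. -/
def IsFar {n : ℕ} (ε : ℝ) (μ : PMF (Fin n)) (P : Set (PMF (Fin n))) : Prop :=
  ∀ ν ∈ P, ε ≤ tvDist μ ν

/-- `T` is a tester for the property `P` of distributions over a domain of size `n`, with distance
parameter `ε` and error probability `δ`, that takes at most `s` conditional samples. -/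
structure IsTester {n : ℕ} (T : NonAdaptiveAlgorithm n) (P : Set (PMF (Fin n))) (ε δ : ℝ) (s : ℕ) :
    Prop where
  usesAtMost : T.UsesAtMost s
  accepts : ∀ μ ∈ P, 1 - δ ≤ (T.run μ true).toReal
  rejects : ∀ μ, IsFar ε μ P → 1 - δ ≤ (T.run μ false).toReal

/-! ### Uniformity and the even uniblock distribution -/

/-- The uniform distribution over a domain of size `n`. -/
def uniformDist (n : ℕ) (hn : 0 < n) : PMF (Fin n) :=
  PMF.uniformOfFinset Finset.univ ⟨⟨0, hn⟩, Finset.mem_univ _⟩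

/-- The property of being the uniform distribution. -/
def uniformity (n : ℕ) : Set (PMF (Fin n)) :=
  {μ | ∃ hn : 0 < n, μ = uniformDist n hn}

/-- The integers `k` with `(1/8) log₂ n ≤ k ≤ (3/8) log₂ n`. -/
def uniblockExponents (n : ℕ) : Finset ℕ :=
  Finset.Icc ⌈(1 / 8 : ℝ) * Real.logb 2 n⌉₊ ⌊(3 / 8 : ℝ) * Real.logb 2 n⌋₊

/-- The subsets of the domain of size exactly `2 ^ (2 * k)`. -/
def evenBlocks (n k : ℕ) : Finset (Finset (Fin n)) :=
  Finset.powersetCard (2 ^ (2 * k)) Finset.univ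

theorem four_le_logb {n : ℕ} (hn : 16 ≤ n) : 4 ≤ Real.logb 2 n := by
  have h : (16 : ℝ) ≤ n := by exact_mod_cast hn
  rw [Real.le_logb_iff_rpow_le (by norm_num) (by linarith)]
  have : (2 : ℝ) ^ (4 : ℝ) = 16 := by
    rw [show (4 : ℝ) = ((4 : ℕ) : ℝ) by norm_num, Real.rpow_natCast]; norm_num
  linarith

theorem uniblockExponents_nonempty {n : ℕ} (hn : 16 ≤ n) : (uniblockExponents n).Nonempty := by
  have h := four_le_logb hn
  rw [uniblockExponents, Finset.nonempty_Icc]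
  apply Nat.le_floor
  have := Nat.ceil_lt_add_one (show (0 : ℝ) ≤ 1 / 8 * Real.logb 2 n by linarith)
  linarith

theorem evenBlocks_nonempty {n k : ℕ} (hn : 16 ≤ n) (hk : k ∈ uniblockExponents n) :
    (evenBlocks n k).Nonempty := by
  have h := four_le_logb hn
  have h16 : (16 : ℝ) ≤ n := by exact_mod_cast hn
  have hk2 := (Finset.mem_Icc.1 hk).2
  rw [Nat.le_floor_iff (by linarith)] at hk2
  rw [evenBlocks, Finset.powersetCard_nonempty, Finset.card_univ, Fintype.card_fin]
  have h2 : ((2 * k : ℕ) : ℝ) ≤ Real.logb 2 n := by push_cast; linarith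
  rw [Real.le_logb_iff_rpow_le (by norm_num) (by linarith), Real.rpow_natCast] at h2
  exact_mod_cast h2

theorem nonempty_of_mem_evenBlocks {n k : ℕ} {U : Finset (Fin n)} (hU : U ∈ evenBlocks n k) :
    U.Nonempty := by
  rw [← Finset.card_pos, (Finset.mem_powersetCard.1 hU).2]
  positivity

/-- The even uniblock distribution over distributions: choose uniformly an integer `k` with
`(1/8) log₂ n ≤ k ≤ (3/8) log₂ n`, then choose uniformly a set `U` of size `2 ^ (2 * k)`; the
output is the uniform distribution over `U`. -/
def evenUniblock (n : ℕ) (hn : 16 ≤ n) : PMF (PMF (Fin n)) :=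
  (PMF.uniformOfFinset (uniblockExponents n).attach
      (uniblockExponents_nonempty hn).attach).bind fun k =>
    (PMF.uniformOfFinset (evenBlocks n k.1).attach (evenBlocks_nonempty hn k.2).attach).map
      fun U => PMF.uniformOfFinset U.1 (nonempty_of_mem_evenBlocks U.2)

end CondSampling

end

/-! Fix the coins, hence the condition sets `A i`, and put l = `logLog n`, K = 4^l. A block of size
m = 4^k meets `A i` in about |A i|m/n points. If this number is at least K, the set is big: its
intersection with the block has a predictable size, and a sample from it looks like a fresh uniform
one. If it is at most 1/K, the set is small: the block probably misses it, and the sample is drawn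
uniformly from `A i` by convention. In both cases the sample reveals almost nothing.

Each set is neither big nor small for at most 2l exponents k, so at most 2l² exponents are bad, out
of at least 2^l/8. All other exponents give error O(l²/2^l), whence `advantageBound`.

For a good exponent, `prod_inv_card_le_average` compares the two laws pointwise on typical sample
sequences: the big samples are distinct and avoid the small sets. The product of 1/|U ∩ A i| is
bounded below by an expression linear in the sizes |U ∩ A i|, so first moments conditional on J ⊆ U
suffice and no concentration inequality is needed. `sum_flatWeight_le_average` adds the mass of the
atypical sequences. Its bound is one-sided; applying it to both decisions makes it two-sided. -/

open Finset

noncomputable section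

namespace CondSampling

/-! ### Elementary inequality and flat weights -/

section Combinatorics

variable {α ι : Type*} [DecidableEq α]

/-- Two tangent-line bounds, log y ≤ y - 1 and 1 + x ≤ exp x. A product of reciprocals is thereby
replaced by something linear, which can be averaged using means alone. -/
theorem one_add_sum_one_sub_le_prod_inv (s : Finset ι) (y : ι → ℝ) (hy : ∀ i ∈ s, 0 < y i) :
    1 + ∑ i ∈ s, (1 - y i) ≤ ∏ i ∈ s, (y i)⁻¹ := by
  have h1 : ∏ i ∈ s, (y i)⁻¹ = Real.exp (∑ i ∈ s, -Real.log (y i)) := by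
    rw [Real.exp_sum]
    exact prod_congr rfl fun i hi => by rw [Real.exp_neg, Real.exp_log (hy i hi)]
  rw [h1]
  have h2 : ∑ i ∈ s, (1 - y i) ≤ ∑ i ∈ s, -Real.log (y i) :=
    sum_le_sum fun i hi => by linarith [Real.log_le_sub_one_of_pos (hy i hi)]
  linarith [Real.add_one_le_exp (∑ i ∈ s, -Real.log (y i))]

/-- The weight of `x` under the uniform distribution on `S`. -/
def flatWeight (S : Finset α) (x : α) : ℝ := if x ∈ S then (#S : ℝ)⁻¹ else 0

/-- The set from which a conditional sample with condition set `A` is drawn uniformly when the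
input distribution is uniform on `U`. -/
def visiblePart (U A : Finset α) : Finset α := if (U ∩ A).Nonempty then U ∩ A else A

theorem flatWeight_nonneg (S : Finset α) (x : α) : 0 ≤ flatWeight S x := by
  unfold flatWeight; split_ifs <;> positivity

theorem flatWeight_le (S : Finset α) (x : α) : flatWeight S x ≤ (#S : ℝ)⁻¹ := by
  unfold flatWeight; split_ifs <;> simp

theorem visiblePart_nonempty (U : Finset α) {A : Finset α} (hA : A.Nonempty) :
    (visiblePart U A).Nonempty := by
  unfold visiblePart; split_ifs with h
  exacts [h, hA]

/-! ### Random sets of a fixed size: inclusion probabilities and mean intersections -/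

variable [Fintype α] [Fintype ι] [DecidableEq ι]

/-- The number of sets of size `m` that contain `J`. -/
def supersetCount (m : ℕ) (J : Finset α) : ℕ :=
  #{U ∈ powersetCard m (univ : Finset α) | J ⊆ U}

theorem supersetCount_empty (m : ℕ) :
    supersetCount m (∅ : Finset α) = (Fintype.card α).choose m := by
  simp [supersetCount]

/-- Double counting of the pairs `(x, U)` with `x ∈ A` and `J ∪ {x} ⊆ U`. -/
theorem sum_supersetCount_insert (m : ℕ) (J A : Finset α) :
    ∑ x ∈ A, supersetCount m (insert x J) =
      ∑ U ∈ powersetCard m (univ : Finset α) with J ⊆ U, #(U ∩ A) := by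
  simp only [supersetCount, card_eq_sum_ones, sum_filter]
  rw [sum_comm]
  refine sum_congr rfl fun U _ => ?_
  by_cases hJ : J ⊆ U
  · simp only [insert_subset_iff, hJ, and_true, if_true]
    rw [← sum_filter, filter_mem_eq_inter, inter_comm]
  · simp [insert_subset_iff, hJ]

theorem supersetCount_eq_choose {m : ℕ} {J : Finset α} (h : #J ≤ m) :
    supersetCount m J = (Fintype.card α - #J).choose (m - #J) := by
  rw [← card_compl, ← card_powersetCard, supersetCount]
  refine card_bij' (fun U _ => U \ J) (fun V _ => V ∪ J) ?_ ?_ ?_ ?_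
  · intro U hU
    simp only [mem_filter, mem_powersetCard, subset_univ, true_and] at hU
    rw [mem_powersetCard, card_sdiff_of_subset hU.2, hU.1]
    exact ⟨fun x hx => by simpa using (mem_sdiff.1 hx).2, rfl⟩
  · intro V hV
    rw [mem_powersetCard] at hV
    have hd : Disjoint V J := disjoint_left.2 fun x hx => mem_compl.1 (hV.1 hx)
    simp only [mem_filter, mem_powersetCard, subset_univ, true_and, subset_union_right, and_true]
    rw [card_union_of_disjoint hd, hV.2]
    omega
  · intro U hU
    simp only [mem_filter] at hU
    exact sdiff_union_of_subset hU.2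
  · intro V hV
    rw [mem_powersetCard] at hV
    have hd : Disjoint V J := disjoint_left.2 fun x hx => mem_compl.1 (hV.1 hx)
    exact union_sdiff_cancel_right hd

theorem supersetCount_eq_zero {m : ℕ} {J : Finset α} (h : m < #J) : supersetCount m J = 0 := by
  rw [supersetCount, card_eq_zero, filter_eq_empty_iff]
  intro U hU hJ
  have := card_le_card hJ
  rw [(mem_powersetCard.1 hU).2] at this
  omega

/-- The conditional probability that x ∈ U given J ⊆ U is (m - |J|)/(n - |J|), by the absorption
identity for binomials. For |J| ≥ m the truncated subtraction makes the right side vanish, as does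
the count on the left. -/
theorem supersetCount_insert_mul {m : ℕ} {J : Finset α} {x : α} (hx : x ∉ J) :
    supersetCount m (insert x J) * (Fintype.card α - #J) = supersetCount m J * (m - #J) := by
  have hc := card_insert_of_notMem hx
  rcases lt_or_ge #J m with h | h
  · rw [supersetCount_eq_choose (J := insert x J) (by omega), supersetCount_eq_choose h.le, hc]
    have hn : #J + 1 ≤ Fintype.card α := by rw [← hc]; exact card_le_univ _
    obtain ⟨a, ha⟩ := Nat.exists_eq_add_of_le hn
    obtain ⟨d, hd⟩ := Nat.exists_eq_add_of_le (Nat.succ_le_of_lt h)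
    have e1 : Fintype.card α - (#J + 1) = a := by omega
    have e2 : Fintype.card α - #J = a + 1 := by omega
    have e3 : m - (#J + 1) = d := by omega
    have e4 : m - #J = d + 1 := by omega
    rw [e1, e2, e3, e4, mul_comm, Nat.add_one_mul_choose_eq]
  · rw [supersetCount_eq_zero (by omega), Nat.sub_eq_zero_of_le h]
    simp

theorem supersetCount_insert_mul_card_le {m : ℕ} (hm : m ≤ Fintype.card α) {J : Finset α} {x : α}
    (hx : x ∉ J) :
    supersetCount m (insert x J) * Fintype.card α ≤ supersetCount m J * m := by
  have hc := card_insert_of_notMem hx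
  rcases lt_or_ge #J m with h | h
  · have key := supersetCount_insert_mul (m := m) hx
    have hn : #J < Fintype.card α := by omega
    -- With n = |J| + a and m = |J| + d, the identity reads p·a = q·d; adding p·|J| ≤ q·|J| gives
    -- p·n ≤ q·m.
    have hle : supersetCount m (insert x J) ≤ supersetCount m J := by
      refine card_le_card fun U hU => ?_
      simp only [mem_filter, insert_subset_iff] at hU ⊢
      exact ⟨hU.1, hU.2.2⟩
    obtain ⟨a, ha⟩ := Nat.exists_eq_add_of_le hn.le
    obtain ⟨d, hd⟩ := Nat.exists_eq_add_of_le h.le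
    rw [show Fintype.card α - #J = a by omega, show m - #J = d by omega] at key
    generalize supersetCount m (insert x J) = p at *
    generalize supersetCount m J = q at *
    rw [ha, hd]
    nlinarith
  · rw [supersetCount_eq_zero (by omega)]
    simp

theorem mul_sub_le_supersetCount_insert {m : ℕ} {J : Finset α} {x : α} (hx : x ∉ J) :
    (supersetCount m J : ℝ) * (m - #J) ≤ supersetCount m (insert x J) * Fintype.card α := by
  rcases le_total #J m with h | h
  · have key := supersetCount_insert_mul (m := m) hx
    have : supersetCount m J * (m - #J) ≤ supersetCount m (insert x J) * Fintype.card α := by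
      rw [← key]
      exact Nat.mul_le_mul_left _ (Nat.sub_le _ _)
    rw [← Nat.cast_sub h]
    exact_mod_cast this
  · have h' : (m : ℝ) ≤ #J := by exact_mod_cast h
    exact (mul_nonpos_of_nonneg_of_nonpos (by positivity) (by linarith)).trans (by positivity)

/-- The probability that a random set of size `m` contains `J`, relative to its value for
independent sampling. -/
def inclusionRatio (m : ℕ) (J : Finset α) : ℝ :=
  supersetCount m J / (Fintype.card α).choose m * ((Fintype.card α : ℝ) / m) ^ #J

/-- Adding a point to J multiplies the ratio by at most 1 and lowers it by at most |J|/m; these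
losses sum to at most |J|²/m. -/
theorem inclusionRatio_bounds {m : ℕ} (hm0 : 0 < m) (hm : m ≤ Fintype.card α) (J : Finset α) :
    1 - (#J : ℝ) ^ 2 / m ≤ inclusionRatio m J ∧ inclusionRatio m J ≤ 1 := by
  have hC : (0 : ℝ) < (Fintype.card α).choose m := by exact_mod_cast Nat.choose_pos hm
  have hm' : (0 : ℝ) < m := by exact_mod_cast hm0
  have hn' : (0 : ℝ) < Fintype.card α := by exact_mod_cast hm0.trans_le hm
  induction J using Finset.induction_on with
  | empty => simp [inclusionRatio, supersetCount_empty, hC.ne']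
  | insert x J hx ih =>
    have hstep : inclusionRatio m (insert x J) =
        (supersetCount m (insert x J) * Fintype.card α) *
          (((Fintype.card α : ℝ) / m) ^ #J / (Fintype.card α).choose m / m) := by
      rw [inclusionRatio, card_insert_of_notMem hx, pow_succ]; field_simp
    have hr : inclusionRatio m J = supersetCount m J * m *
        (((Fintype.card α : ℝ) / m) ^ #J / (Fintype.card α).choose m / m) := by
      rw [inclusionRatio]; field_simp
    set c := ((Fintype.card α : ℝ) / m) ^ #J / (Fintype.card α).choose m / m with hcdef
    have hc : 0 ≤ c := by positivity
    have hup : (supersetCount m (insert x J) : ℝ) * Fintype.card α ≤ supersetCount m J * m := by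
      exact_mod_cast supersetCount_insert_mul_card_le hm hx
    have hlo := mul_sub_le_supersetCount_insert (m := m) hx
    have h1 := mul_le_mul_of_nonneg_right hup hc
    have h2 := mul_le_mul_of_nonneg_right hlo hc
    rw [← hstep, ← hr] at h1
    rw [← hstep] at h2
    refine ⟨?_, h1.trans ih.2⟩
    have h3 : (supersetCount m J : ℝ) * (m - #J) * c =
        inclusionRatio m J - inclusionRatio m J * (#J / m) := by
      rw [hr]; field_simp
    have h4 : inclusionRatio m J * (#J / m : ℝ) ≤ #J / m :=
      mul_le_of_le_one_left (by positivity) ih.2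
    have h5 : ((#(insert x J) : ℕ) : ℝ) ^ 2 / m = (#J : ℝ) ^ 2 / m + 2 * (#J / m) + 1 / m := by
      rw [card_insert_of_notMem hx]; push_cast; field_simp; ring
    have h6 : (0 : ℝ) ≤ #J / m := by positivity
    have h7 : (0 : ℝ) ≤ 1 / m := by positivity
    rw [h5]
    linarith [ih.1]

/-- The mean size of `U ∩ A` over the sets `U` of size `m` that contain `J`. -/
theorem sum_card_inter_le {m : ℕ} (hm0 : 0 < m) (hm : m ≤ Fintype.card α) (J A : Finset α) :
    ∑ U ∈ powersetCard m (univ : Finset α) with J ⊆ U, (#(U ∩ A) : ℝ) ≤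
      supersetCount m J * (#(A ∩ J) + #A * m / Fintype.card α) := by
  have hn' : (0 : ℝ) < Fintype.card α := by exact_mod_cast hm0.trans_le hm
  rw [← Nat.cast_sum, ← sum_supersetCount_insert, Nat.cast_sum]
  have h : ∀ x ∈ A, (supersetCount m (insert x J) : ℝ) ≤
      (if x ∈ J then (supersetCount m J : ℝ) else 0) +
        supersetCount m J * m / Fintype.card α := by
    intro x _
    by_cases hx : x ∈ J
    · rw [insert_eq_of_mem hx, if_pos hx]
      have : (0 : ℝ) ≤ supersetCount m J * m / Fintype.card α := by positivity
      linarith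
    · rw [if_neg hx, zero_add, le_div_iff₀ hn']
      exact_mod_cast supersetCount_insert_mul_card_le hm hx
  refine (sum_le_sum h).trans_eq ?_
  rw [sum_add_distrib, ← sum_filter, filter_mem_eq_inter, sum_const, sum_const]
  simp only [nsmul_eq_mul]
  ring

/-! ### Independent uniform samples: collisions and hits -/

theorem sum_flatWeight {S : Finset α} (hS : S.Nonempty) : ∑ x, flatWeight S x = 1 := by
  have : (#S : ℝ) ≠ 0 := by exact_mod_cast hS.card_pos.ne'
  simp [flatWeight, this]

theorem sum_prod_flatWeight {S : ι → Finset α} (hS : ∀ i, (S i).Nonempty) :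
    ∑ j : ι → α, ∏ i, flatWeight (S i) (j i) = 1 := by
  rw [← Fintype.prod_sum]
  exact prod_eq_one fun i _ => sum_flatWeight (hS i)

theorem sum_prod_flatWeight_ite {S : ι → Finset α} (hS : ∀ i, (S i).Nonempty) (s : Finset ι)
    (x : α) :
    ∑ j : ι → α, (if ∀ i ∈ s, j i = x then ∏ i, flatWeight (S i) (j i) else 0) =
      ∏ i ∈ s, flatWeight (S i) x := by
  -- The event is a product event, so its indicator is absorbed into the factors and the sum
  -- factorizes.
  have h : ∀ j : ι → α, (if ∀ i ∈ s, j i = x then ∏ i, flatWeight (S i) (j i) else 0) =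
      ∏ i, (if i ∈ s then (if j i = x then flatWeight (S i) x else 0)
        else flatWeight (S i) (j i)) := by
    intro j
    split_ifs with hj
    · refine prod_congr rfl fun i _ => ?_
      by_cases hi : i ∈ s
      · simp [hi, hj i hi]
      · simp [hi]
    · push Not at hj
      obtain ⟨i, hi, hne⟩ := hj
      exact (prod_eq_zero (mem_univ i) (by simp [hi, hne])).symm
  simp_rw [h]
  rw [← Fintype.prod_sum (fun i y => if i ∈ s then (if y = x then flatWeight (S i) x else 0)
        else flatWeight (S i) y)]
  refine (prod_congr rfl fun i _ => ?_).trans (Fintype.prod_ite_mem s fun i => flatWeight (S i) x)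
  split_ifs with hi
  · simp
  · exact sum_flatWeight (hS i)

theorem sum_prod_flatWeight_mem_le {S : ι → Finset α} (hS : ∀ i, (S i).Nonempty) (i : ι)
    (W : Finset α) :
    ∑ j : ι → α, (if j i ∈ W then ∏ i, flatWeight (S i) (j i) else 0) ≤ #W * (#(S i) : ℝ)⁻¹ := by
  have h : ∀ j : ι → α, (if j i ∈ W then ∏ i, flatWeight (S i) (j i) else 0) =
      ∑ x ∈ W, (if ∀ l ∈ ({i} : Finset ι), j l = x then ∏ i, flatWeight (S i) (j i) else 0) := by
    intro j; simp
  simp_rw [h]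
  rw [sum_comm]
  simp_rw [sum_prod_flatWeight_ite hS, prod_singleton]
  refine (sum_le_sum fun x _ => flatWeight_le (S i) x).trans_eq ?_
  simp

theorem sum_prod_flatWeight_eq_le {S : ι → Finset α} (hS : ∀ i, (S i).Nonempty) {i i' : ι}
    (hi : i ≠ i') :
    ∑ j : ι → α, (if j i = j i' then ∏ i, flatWeight (S i) (j i) else 0) ≤ (#(S i) : ℝ)⁻¹ := by
  have h : ∀ j : ι → α, (if j i = j i' then ∏ i, flatWeight (S i) (j i) else 0) =
      ∑ x, (if ∀ l ∈ ({i, i'} : Finset ι), j l = x then ∏ i, flatWeight (S i) (j i) else 0) := by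
    intro j
    by_cases hj : j i = j i'
    · simp [hj]
    · rw [if_neg hj, sum_eq_zero]
      intro x _
      rw [if_neg]
      intro hx
      exact hj ((hx i (by simp)).trans (hx i' (by simp)).symm)
  simp_rw [h]
  rw [sum_comm]
  simp_rw [sum_prod_flatWeight_ite hS, prod_pair hi]
  calc ∑ x, flatWeight (S i) x * flatWeight (S i') x
      ≤ ∑ x, (#(S i) : ℝ)⁻¹ * flatWeight (S i') x :=
        sum_le_sum fun x _ => mul_le_mul_of_nonneg_right (flatWeight_le _ _) (flatWeight_nonneg _ _)
    _ = _ := by rw [← mul_sum, sum_flatWeight (hS i'), mul_one]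

end Combinatorics

/-! ### Averaging over blocks of one size -/

section Averaging

variable {α ι : Type*} [DecidableEq α] [Fintype α] [Fintype ι] [DecidableEq ι]

/-- A minorant, for a single block U, that is affine in the intersection sizes. If U misses all sets
outside B, the tangent-line inequality applies; otherwise the penalty (1 + |B|)·|U ∩ W|, with W the
union of those sets, makes the minorant nonpositive. -/
theorem prod_inv_card_mul_le_prod_flatWeight_visiblePart {m : ℕ} (hm0 : 0 < m)
    (hm : m ≤ Fintype.card α) {A : ι → Finset α} (B : Finset ι) {j : ι → α}
    (hj : ∀ i, j i ∈ A i) (U : Finset α) :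
    (∏ i, (#(A i) : ℝ)⁻¹) * ((Fintype.card α : ℝ) / m) ^ #B *
      (if B.image j ⊆ U then
        1 + ∑ i ∈ B, (1 - #(U ∩ A i) / (#(A i) * m / Fintype.card α : ℝ)) -
          (1 + #B) * #(U ∩ Bᶜ.biUnion A) else 0) ≤
      ∏ i, flatWeight (visiblePart U (A i)) (j i) := by
  have hm' : (0 : ℝ) < m := by exact_mod_cast hm0
  have hn' : (0 : ℝ) < Fintype.card α := by exact_mod_cast hm0.trans_le hm
  have hA : ∀ i, (0 : ℝ) < #(A i) := fun i => by exact_mod_cast card_pos.2 ⟨j i, hj i⟩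
  have hnn : 0 ≤ ∏ i, flatWeight (visiblePart U (A i)) (j i) :=
    prod_nonneg fun i _ => flatWeight_nonneg _ _
  have hpos : 0 ≤ (∏ i, (#(A i) : ℝ)⁻¹) * ((Fintype.card α : ℝ) / m) ^ #B := by positivity
  split_ifs with hJ
  swap
  · simpa using hnn
  set y : ι → ℝ := fun i => #(U ∩ A i) / (#(A i) * m / Fintype.card α : ℝ) with hy
  rcases (U ∩ Bᶜ.biUnion A).eq_empty_or_nonempty with hE | hE
  · have hyp : ∀ i ∈ B, 0 < y i := by
      intro i hi
      have h1 : (0 : ℝ) < #(U ∩ A i) := by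
        exact_mod_cast card_pos.2 ⟨j i, mem_inter.2 ⟨hJ (mem_image_of_mem j hi), hj i⟩⟩
      have h2 := hA i
      simp only [hy]
      positivity
    have hprod : ∏ i, flatWeight (visiblePart U (A i)) (j i) =
        (∏ i, (#(A i) : ℝ)⁻¹) * ((Fintype.card α : ℝ) / m) ^ #B * ∏ i ∈ B, (y i)⁻¹ := by
      rw [mul_assoc, ← prod_const, ← prod_mul_distrib, ← Fintype.prod_ite_mem B, ← prod_mul_distrib]
      refine prod_congr rfl fun i _ => ?_
      split_ifs with hi
      · have hmem : j i ∈ U ∩ A i := mem_inter.2 ⟨hJ (mem_image_of_mem j hi), hj i⟩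
        rw [visiblePart, if_pos ⟨_, hmem⟩, flatWeight, if_pos hmem]
        have h1 : (#(U ∩ A i) : ℝ) ≠ 0 := by exact_mod_cast (card_pos.2 ⟨_, hmem⟩).ne'
        have h2 := (hA i).ne'
        simp only [hy]
        field_simp
      · have hemp : ¬ (U ∩ A i).Nonempty := by
          rintro ⟨x, hx⟩
          have : x ∈ U ∩ Bᶜ.biUnion A :=
            mem_inter.2 ⟨(mem_inter.1 hx).1, mem_biUnion.2 ⟨i, by simpa using hi,
              (mem_inter.1 hx).2⟩⟩
          simp [hE] at this
        rw [visiblePart, if_neg hemp, flatWeight, if_pos (hj i), mul_one]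
    rw [hprod, hE]
    refine mul_le_mul_of_nonneg_left ?_ hpos
    simpa using one_add_sum_one_sub_le_prod_inv B y hyp
  · refine (mul_nonpos_of_nonneg_of_nonpos hpos ?_).trans hnn
    have h1 : (1 : ℝ) ≤ #(U ∩ Bᶜ.biUnion A) := by exact_mod_cast hE.card_pos
    have h2 : ∑ i ∈ B, (1 - y i) ≤ #B := by
      have h3 : ∀ i ∈ B, 1 - y i ≤ 1 := fun i _ => by
        have : 0 ≤ y i := by simp only [hy]; positivity
        linarith
      simpa using sum_le_sum h3
    have h3 := mul_le_mul_of_nonneg_left h1 (by positivity : (0 : ℝ) ≤ 1 + #B)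
    simp only [hy] at h2
    linarith

theorem card_biUnion_mul_le {m : ℕ} {K : ℝ} (hK : 0 < K) {A : ι → Finset α} (B : Finset ι)
    (hsmall : ∀ i ∉ B, K * (#(A i) * m) ≤ Fintype.card α) :
    (#(Bᶜ.biUnion A) : ℝ) * m ≤ #Bᶜ * (Fintype.card α / K) := by
  have h1 : (#(Bᶜ.biUnion A) : ℝ) ≤ ∑ i ∈ Bᶜ, (#(A i) : ℝ) := by exact_mod_cast card_biUnion_le
  calc (#(Bᶜ.biUnion A) : ℝ) * m ≤ (∑ i ∈ Bᶜ, (#(A i) : ℝ)) * m := by gcongr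
    _ = ∑ i ∈ Bᶜ, (#(A i) : ℝ) * m := sum_mul _ _ _
    _ ≤ ∑ _i ∈ Bᶜ, (Fintype.card α / K : ℝ) := by
        refine sum_le_sum fun i hi => ?_
        rw [le_div_iff₀ hK, mul_comm]
        exact hsmall i (mem_compl.1 hi)
    _ = _ := by simp

/-- On typical sample sequences the averaged law of the samples is almost at least the law of
samples from the uniform distribution. -/
theorem prod_inv_card_le_average {m : ℕ} (hm0 : 0 < m) (hm : m ≤ Fintype.card α) {K : ℝ}
    (hK : 1 ≤ K) {A : ι → Finset α} (B : Finset ι)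
    (hbig : ∀ i ∈ B, K * Fintype.card α ≤ #(A i) * m)
    (hsmall : ∀ i ∉ B, K * (#(A i) * m) ≤ Fintype.card α) {j : ι → α} (hj : ∀ i, j i ∈ A i)
    (hinj : Set.InjOn j B) (hdisj : ∀ i ∈ B, j i ∉ Bᶜ.biUnion A) :
    (∏ i, (#(A i) : ℝ)⁻¹) *
        (1 - ((Fintype.card ι : ℝ) ^ 2 / m + 2 * (Fintype.card ι : ℝ) ^ 2 / K)) ≤
      (∑ U ∈ powersetCard m univ, ∏ i, flatWeight (visiblePart U (A i)) (j i)) /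
        (Fintype.card α).choose m := by
  have hm' : (0 : ℝ) < m := by exact_mod_cast hm0
  have hn' : (0 : ℝ) < Fintype.card α := by exact_mod_cast hm0.trans_le hm
  have hK0 : 0 < K := by linarith
  have hC : (0 : ℝ) < (Fintype.card α).choose m := by exact_mod_cast Nat.choose_pos hm
  set W := Bᶜ.biUnion A with hW
  set J := B.image j with hJ
  set n : ℝ := ((Fintype.card α : ℕ) : ℝ) with hn
  set t : ℝ := ((Fintype.card ι : ℕ) : ℝ) with ht
  have hJcard : #J = #B := card_image_of_injOn hinj
  have hWJ : #(W ∩ J) = 0 := by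
    rw [card_eq_zero, ← disjoint_iff_inter_eq_empty, disjoint_right]
    intro x hx
    obtain ⟨i, hi, rfl⟩ := mem_image.1 hx
    exact hdisj i hi
  have hbt : (#B : ℝ) + #Bᶜ = t := by rw [ht]; exact_mod_cast card_add_card_compl B
  have hb0 : (0 : ℝ) ≤ #B := by positivity
  -- Integrality gives s ≤ s² for s = |Bᶜ|, needed to bound |B|² + (1 + |B|)s by 2t².
  have hs0 : (#Bᶜ : ℝ) = 0 ∨ (1 : ℝ) ≤ #Bᶜ := by
    rcases Nat.eq_zero_or_pos #Bᶜ with h | h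
    · left; exact_mod_cast h
    · right; exact_mod_cast h
  have hsum : (supersetCount m J : ℝ) * (1 - 2 * t ^ 2 / K) ≤
      ∑ U ∈ powersetCard m (univ : Finset α) with J ⊆ U,
        (1 + ∑ i ∈ B, (1 - #(U ∩ A i) / (#(A i) * m / n : ℝ)) - (1 + #B) * #(U ∩ W)) := by
    rw [sum_sub_distrib, sum_add_distrib, sum_comm, ← mul_sum]
    simp_rw [sum_sub_distrib, ← sum_div]
    have hN : ∑ U ∈ powersetCard m (univ : Finset α) with J ⊆ U, (1 : ℝ) = supersetCount m J := by
      simp [supersetCount]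
    rw [hN]
    have h1 : ∀ i ∈ B, (∑ U ∈ powersetCard m (univ : Finset α) with J ⊆ U, (#(U ∩ A i) : ℝ)) /
        (#(A i) * m / n) ≤ supersetCount m J * (#B / K + 1) := by
      intro i hi
      have hAi : (0 : ℝ) < #(A i) := by exact_mod_cast card_pos.2 ⟨j i, hj i⟩
      have hc : K ≤ #(A i) * m / n := by rw [le_div_iff₀ hn']; exact hbig i hi
      have hc0 : 0 < #(A i) * m / n := by positivity
      rw [div_le_iff₀ hc0]
      refine (sum_card_inter_le hm0 hm J (A i)).trans ?_
      rw [mul_assoc]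
      refine mul_le_mul_of_nonneg_left ?_ (by positivity)
      have h2 : (#(A i ∩ J) : ℝ) ≤ #B := by
        rw [← hJcard]; exact_mod_cast card_le_card inter_subset_right
      -- The points of J forced into U are negligible against the mean |A i|m/n ≥ K.
      have h3 : (#B : ℝ) ≤ #B / K * (#(A i) * m / n) := by
        rw [div_mul_eq_mul_div, le_div_iff₀ hK0]
        gcongr
      linarith
    have h2 := sum_le_sum h1
    rw [sum_const, nsmul_eq_mul] at h2
    have h3 := sum_card_inter_le hm0 hm J W
    rw [hWJ, Nat.cast_zero, zero_add] at h3
    have h4 : (#W : ℝ) * m / n ≤ #Bᶜ / K := by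
      rw [div_le_iff₀ hn']
      refine (card_biUnion_mul_le hK0 B hsmall).trans_eq ?_
      ring
    have h5 : ∑ U ∈ powersetCard m (univ : Finset α) with J ⊆ U, (#(U ∩ W) : ℝ) ≤
        supersetCount m J * (#Bᶜ / K) :=
      h3.trans (mul_le_mul_of_nonneg_left h4 (Nat.cast_nonneg _))
    have h6 : (1 + (#B : ℝ)) * ∑ U ∈ powersetCard m (univ : Finset α) with J ⊆ U, (#(U ∩ W) : ℝ) ≤
        (1 + #B) * (supersetCount m J * (#Bᶜ / K)) :=
      mul_le_mul_of_nonneg_left h5 (by linarith)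
    rw [sum_const, nsmul_eq_mul]
    have h7 : (#B : ℝ) ^ 2 / K + (1 + #B) * (#Bᶜ / K) ≤ 2 * t ^ 2 / K := by
      rw [mul_div_assoc', ← add_div]
      gcongr
      rw [← hbt]
      rcases hs0 with h | h
      · rw [h]; nlinarith
      · nlinarith
    have h8 := mul_le_mul_of_nonneg_left h7 (Nat.cast_nonneg (α := ℝ) (supersetCount m J))
    have h9 : (#B : ℝ) * (supersetCount m J * (#B / K + 1)) =
      supersetCount m J * (#B ^ 2 / K) + #B * supersetCount m J := by ring
    linarith
  have hP : 0 ≤ ∏ i, (#(A i) : ℝ)⁻¹ := prod_nonneg fun i _ => by positivity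
  have hpt : (∏ i, (#(A i) : ℝ)⁻¹) * (n / m) ^ #B *
      (supersetCount m J * (1 - 2 * t ^ 2 / K)) ≤
        ∑ U ∈ powersetCard m univ, ∏ i, flatWeight (visiblePart U (A i)) (j i) := by
    refine (mul_le_mul_of_nonneg_left hsum (mul_nonneg hP (by positivity))).trans ?_
    rw [sum_filter, mul_sum]
    exact sum_le_sum fun U _ =>
      prod_inv_card_mul_le_prod_flatWeight_visiblePart hm0 hm B hj U
  rw [le_div_iff₀ hC]
  refine le_trans ?_ hpt
  have hr : (∏ i, (#(A i) : ℝ)⁻¹) * (n / m) ^ #B * (supersetCount m J * (1 - 2 * t ^ 2 / K)) =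
      (∏ i, (#(A i) : ℝ)⁻¹) * (inclusionRatio m J * (1 - 2 * t ^ 2 / K)) *
        (Fintype.card α).choose m := by
    have e : inclusionRatio m J * (Fintype.card α).choose m =
        supersetCount m J * (n / m) ^ #B := by
      rw [inclusionRatio, hJcard, mul_right_comm, div_mul_cancel₀ _ hC.ne']
    rw [mul_assoc _ _ ((Fintype.card α).choose m : ℝ), mul_right_comm (inclusionRatio m J), e]
    ring
  rw [hr]
  refine mul_le_mul_of_nonneg_right (mul_le_mul_of_nonneg_left ?_ hP) hC.le
  obtain ⟨hlo, hup⟩ := inclusionRatio_bounds hm0 hm J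
  rw [hJcard] at hlo
  have h1 : (#B : ℝ) ^ 2 / m ≤ t ^ 2 / m := by
    have : (#B : ℝ) ≤ t := by linarith [(Nat.cast_nonneg #Bᶜ : (0 : ℝ) ≤ _)]
    gcongr
  have h2 : 0 ≤ 2 * t ^ 2 / K := by positivity
  nlinarith

/-- A one-sided bound on the variation distance between the samples from the uniform distribution
and the samples from a random uniform block of size `m`, when the relative sizes of the
condition sets are far from `1 / m`. -/
theorem sum_flatWeight_le_average {m : ℕ} (hm0 : 0 < m) (hm : m ≤ Fintype.card α) {K : ℝ}
    (hK : 1 ≤ K) {A : ι → Finset α} (hA : ∀ i, (A i).Nonempty)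
    (hdich : ∀ i, K * Fintype.card α ≤ #(A i) * m ∨ K * (#(A i) * m) ≤ Fintype.card α)
    {g : (ι → α) → ℝ} (hg0 : ∀ j, 0 ≤ g j) (hg1 : ∀ j, g j ≤ 1) :
    ∑ j, g j * ∏ i, flatWeight (A i) (j i) ≤
      (∑ U ∈ powersetCard m univ, ∑ j, g j * ∏ i, flatWeight (visiblePart U (A i)) (j i)) /
        (Fintype.card α).choose m +
      ((Fintype.card ι : ℝ) ^ 2 / m + 4 * (Fintype.card ι : ℝ) ^ 2 / K) := by
  classical
  have hm' : (0 : ℝ) < m := by exact_mod_cast hm0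
  have hn' : (0 : ℝ) < Fintype.card α := by exact_mod_cast hm0.trans_le hm
  have hK0 : 0 < K := by linarith
  set B : Finset ι := {i | K * Fintype.card α ≤ #(A i) * m} with hB
  have hbig : ∀ i ∈ B, K * Fintype.card α ≤ #(A i) * m := fun i hi => (mem_filter.1 hi).2
  have hsmall : ∀ i ∉ B, K * (#(A i) * m) ≤ Fintype.card α := fun i hi =>
    (hdich i).resolve_left fun h => hi (mem_filter.2 ⟨mem_univ i, h⟩)
  set W := Bᶜ.biUnion A with hW
  set t : ℝ := ((Fintype.card ι : ℕ) : ℝ) with ht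
  set Q : (ι → α) → ℝ := fun j => ∏ i, flatWeight (A i) (j i) with hQ
  set P : (ι → α) → ℝ := fun j =>
    (∑ U ∈ powersetCard m univ, ∏ i, flatWeight (visiblePart U (A i)) (j i)) /
      (Fintype.card α).choose m with hP
  set η := t ^ 2 / m + 2 * t ^ 2 / K with hη
  have hη0 : 0 ≤ η := by positivity
  have hQ0 : ∀ j, 0 ≤ Q j := fun j => prod_nonneg fun i _ => flatWeight_nonneg _ _
  have hP0 : ∀ j, 0 ≤ P j := fun j =>
    div_nonneg (sum_nonneg fun U _ => prod_nonneg fun i _ => flatWeight_nonneg _ _) (by positivity)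
  -- Union bound for atypical sequences: two big samples collide, or a big sample falls in a small
  -- set.
  set bad : (ι → α) → ℝ := fun j =>
    ∑ p ∈ B.offDiag, (if j p.1 = j p.2 then Q j else 0) +
      ∑ i ∈ B, (if j i ∈ W then Q j else 0) with hbad
  have hite : ∀ (c : Prop) [Decidable c] (j), 0 ≤ if c then Q j else 0 := by
    intro c _ j; split_ifs; exacts [hQ0 j, le_rfl]
  have hbad0 : ∀ j, 0 ≤ bad j := fun j =>
    add_nonneg (sum_nonneg fun _ _ => hite _ _) (sum_nonneg fun _ _ => hite _ _)
  have hpt : ∀ j, g j * Q j ≤ g j * P j + η * Q j + bad j := by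
    intro j
    have hgP : 0 ≤ g j * P j := mul_nonneg (hg0 j) (hP0 j)
    have hηQ : 0 ≤ η * Q j := mul_nonneg hη0 (hQ0 j)
    have hgQ : g j * Q j ≤ Q j := mul_le_of_le_one_left (hQ0 j) (hg1 j)
    by_cases hmem : ∀ i, j i ∈ A i
    swap
    · push Not at hmem
      obtain ⟨i, hi⟩ := hmem
      have : Q j = 0 := prod_eq_zero (mem_univ i) (by simp [flatWeight, hi])
      have := hbad0 j
      linarith
    by_cases hinj : Set.InjOn j B
    swap
    · simp only [Set.InjOn, mem_coe] at hinj
      push Not at hinj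
      obtain ⟨i, hi, i', hi', heq, hne⟩ := hinj
      have h1 : Q j ≤ ∑ p ∈ B.offDiag, (if j p.1 = j p.2 then Q j else 0) := by
        have := single_le_sum (f := fun p : ι × ι => if j p.1 = j p.2 then Q j else 0)
          (fun p _ => hite _ _) (mem_offDiag.2 ⟨hi, hi', hne⟩ : (i, i') ∈ B.offDiag)
        simpa [heq] using this
      have h2 : 0 ≤ ∑ i ∈ B, (if j i ∈ W then Q j else 0) := sum_nonneg fun _ _ => hite _ _
      have h3 : Q j ≤ bad j := by simp only [hbad]; linarith
      linarith
    by_cases hdisj : ∀ i ∈ B, j i ∉ W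
    swap
    · push Not at hdisj
      obtain ⟨i, hi, hiW⟩ := hdisj
      have h1 : Q j ≤ ∑ i ∈ B, (if j i ∈ W then Q j else 0) := by
        have := single_le_sum (f := fun i => if j i ∈ W then Q j else 0)
          (fun p _ => hite _ _) hi
        simpa [hiW] using this
      have h2 : 0 ≤ ∑ p ∈ B.offDiag, (if j p.1 = j p.2 then Q j else 0) :=
        sum_nonneg fun _ _ => hite _ _
      have h3 : Q j ≤ bad j := by simp only [hbad]; linarith
      linarith
    have key : Q j * (1 - η) ≤ P j := by
      have hQj : Q j = ∏ i, (#(A i) : ℝ)⁻¹ :=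
        prod_congr rfl fun i _ => by rw [flatWeight, if_pos (hmem i)]
      rw [hQj]
      exact prod_inv_card_le_average hm0 hm hK B hbig hsmall hmem hinj hdisj
    have h1 := mul_le_mul_of_nonneg_left key (hg0 j)
    have h2 : g j * (η * Q j) ≤ η * Q j := mul_le_of_le_one_left hηQ (hg1 j)
    have := hbad0 j
    linarith
  -- Since m ≤ n, a big set has at least K elements, so two samples collide with probability at most
  -- 1/K.
  have hinv : ∀ i ∈ B, (#(A i) : ℝ)⁻¹ ≤ 1 / K := by
    intro i hi
    have hmn : (m : ℝ) ≤ Fintype.card α := by exact_mod_cast hm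
    have : K ≤ #(A i) := by
      have h1 := hbig i hi
      have h2 : (#(A i) : ℝ) * m ≤ #(A i) * Fintype.card α := by gcongr
      exact le_of_mul_le_mul_right (h1.trans h2) hn'
    rw [one_div]
    gcongr
  have hBt : (#B : ℝ) ≤ t := by rw [ht]; exact_mod_cast card_le_univ B
  have ht0 : 0 ≤ t := by positivity
  have hbadsum : ∑ j, bad j ≤ 2 * t ^ 2 / K := by
    simp only [hbad]
    rw [sum_add_distrib, sum_comm, sum_comm (t := B)]
    have h1 : ∑ p ∈ B.offDiag, ∑ j, (if j p.1 = j p.2 then Q j else 0) ≤ t ^ 2 / K := by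
      calc _ ≤ ∑ p ∈ B.offDiag, (1 / K) := by
            refine sum_le_sum fun p hp => ?_
            rw [mem_offDiag] at hp
            exact (sum_prod_flatWeight_eq_le hA hp.2.2).trans (hinv _ hp.1)
        _ = #B.offDiag / K := by rw [sum_const, nsmul_eq_mul, mul_one_div]
        _ ≤ t ^ 2 / K := by
            gcongr
            have : (#B.offDiag : ℝ) ≤ #B * #B := by
              rw [offDiag_card]; exact_mod_cast Nat.sub_le _ _
            nlinarith
    -- A crude bound is enough: against |A i|m ≥ Kn it yields |W|/|A i| ≤ t/K.
    have hWm : (#W : ℝ) * m ≤ t * Fintype.card α := by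
      refine (card_biUnion_mul_le hK0 B hsmall).trans ?_
      have h3 : (#Bᶜ : ℝ) ≤ t := by rw [ht]; exact_mod_cast card_le_univ Bᶜ
      have h4 : (Fintype.card α : ℝ) / K ≤ Fintype.card α := div_le_self hn'.le hK
      gcongr
    have h2 : ∑ i ∈ B, ∑ j, (if j i ∈ W then Q j else 0) ≤ t ^ 2 / K := by
      calc _ ≤ ∑ i ∈ B, t / K := by
            refine sum_le_sum fun i hi => (sum_prod_flatWeight_mem_le hA i W).trans ?_
            have hAi : (0 : ℝ) < #(A i) := by exact_mod_cast (hA i).card_pos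
            rw [← div_eq_mul_inv, div_le_div_iff₀ hAi hK0]
            refine le_of_mul_le_mul_right ?_ hm'
            have h3 := mul_le_mul_of_nonneg_right hWm hK0.le
            have h4 := mul_le_mul_of_nonneg_left (hbig i hi) ht0
            linarith
        _ = #B * (t / K) := by rw [sum_const, nsmul_eq_mul]
        _ ≤ t * (t / K) := by gcongr
        _ = t ^ 2 / K := by ring
    have : 2 * t ^ 2 / K = t ^ 2 / K + t ^ 2 / K := by ring
    linarith
  have hPsum : ∑ j, g j * P j =
      (∑ U ∈ powersetCard m univ, ∑ j, g j * ∏ i, flatWeight (visiblePart U (A i)) (j i)) /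
        (Fintype.card α).choose m := by
    rw [sum_comm, sum_div]
    refine sum_congr rfl fun j _ => ?_
    simp only [hP]
    rw [← mul_sum, mul_div_assoc]
  have hsum := sum_le_sum fun j (_ : j ∈ univ) => hpt j
  rw [sum_add_distrib, sum_add_distrib, ← mul_sum, hPsum, sum_prod_flatWeight hA, mul_one] at hsum
  have : 4 * t ^ 2 / K = 2 * t ^ 2 / K + 2 * t ^ 2 / K := by ring
  linarith

end Averaging

/-! ### From probability mass functions to finite real sums -/

section Laws

variable {γ β : Type*}

theorem toReal_uniformOfFinset_apply {n : ℕ} {S : Finset (Fin n)} (hS : S.Nonempty) (x : Fin n) :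
    (PMF.uniformOfFinset S hS x).toReal = flatWeight S x := by
  rw [PMF.uniformOfFinset_apply, flatWeight]
  split_ifs <;> simp

theorem toReal_uniformOfFinset_bind {s : Finset γ} (hs : s.Nonempty) (f : γ → PMF β) (b : β) :
    ((PMF.uniformOfFinset s hs).bind f b).toReal = (∑ x ∈ s, (f x b).toReal) / #s := by
  rw [PMF.bind_apply, tsum_eq_sum (s := s), ENNReal.toReal_sum, sum_div]
  · refine sum_congr rfl fun x hx => ?_
    rw [PMF.uniformOfFinset_apply_of_mem hs hx, ENNReal.toReal_mul, ENNReal.toReal_inv,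
      ENNReal.toReal_natCast]
    ring
  · exact fun x _ => ENNReal.mul_ne_top (PMF.apply_ne_top _ _) (PMF.apply_ne_top _ _)
  · intro x hx
    rw [PMF.uniformOfFinset_apply_of_notMem hs hx, zero_mul]

theorem toReal_bind_apply_le (p : PMF γ) {f : γ → PMF β} {b : β} {ε : ℝ} (hε : 0 ≤ ε)
    (h : ∀ c ∈ p.support, (f c b).toReal ≤ ε) : (p.bind f b).toReal ≤ ε := by
  refine ENNReal.toReal_le_of_le_ofReal hε ?_
  calc p.bind f b = ∑' c, p c * f c b := PMF.bind_apply _ _ _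
    _ ≤ ∑' c, p c * ENNReal.ofReal ε := by
        refine ENNReal.tsum_le_tsum fun c => ?_
        by_cases hc : c ∈ p.support
        · gcongr
          exact (ENNReal.le_ofReal_iff_toReal_le (PMF.apply_ne_top _ _) hε).2 (h c hc)
        · rw [(PMF.apply_eq_zero_iff p c).2 hc, zero_mul, zero_mul]
    _ = ENNReal.ofReal ε := by rw [ENNReal.tsum_mul_right, PMF.tsum_coe, one_mul]

theorem toReal_bind_apply_le_add (p : PMF γ) {f g : γ → PMF β} {b : β} {ε : ℝ} (hε : 0 ≤ ε)
    (h : ∀ c ∈ p.support, (f c b).toReal ≤ (g c b).toReal + ε) :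
    (p.bind f b).toReal ≤ (p.bind g b).toReal + ε := by
  have hfin : p.bind g b + ENNReal.ofReal ε ≠ ⊤ :=
    ENNReal.add_ne_top.2 ⟨PMF.apply_ne_top _ _, ENNReal.ofReal_ne_top⟩
  have key : p.bind f b ≤ p.bind g b + ENNReal.ofReal ε := by
    calc p.bind f b = ∑' c, p c * f c b := PMF.bind_apply _ _ _
      _ ≤ ∑' c, (p c * g c b + p c * ENNReal.ofReal ε) := by
          refine ENNReal.tsum_le_tsum fun c => ?_
          by_cases hc : c ∈ p.support
          · rw [← mul_add]
            gcongr
            rw [← ENNReal.toReal_le_toReal (PMF.apply_ne_top _ _)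
              (ENNReal.add_ne_top.2 ⟨PMF.apply_ne_top _ _, ENNReal.ofReal_ne_top⟩),
              ENNReal.toReal_add (PMF.apply_ne_top _ _) ENNReal.ofReal_ne_top,
              ENNReal.toReal_ofReal hε]
            exact h c hc
          · simp [(PMF.apply_eq_zero_iff p c).2 hc]
      _ = p.bind g b + ENNReal.ofReal ε := by
          rw [ENNReal.tsum_add, ENNReal.tsum_mul_right, PMF.tsum_coe, one_mul, PMF.bind_apply]
  have := ENNReal.toReal_mono hfin key
  rwa [ENNReal.toReal_add (PMF.apply_ne_top _ _) ENNReal.ofReal_ne_top,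
    ENNReal.toReal_ofReal hε] at this

theorem toReal_true_add_false (p : PMF Bool) : (p true).toReal + (p false).toReal = 1 := by
  have h := p.tsum_coe
  rw [tsum_bool, add_comm] at h
  rw [← ENNReal.toReal_add (PMF.apply_ne_top _ _) (PMF.apply_ne_top _ _), h, ENNReal.toReal_one]

/-- Conditioning a uniform law leaves a uniform law; the zero-weight convention of the model is
exactly the second case of `visiblePart`. -/
theorem condSample_uniformOfFinset {n : ℕ} {U A : Finset (Fin n)} (hU : U.Nonempty)
    (hA : A.Nonempty) :
    condSample (PMF.uniformOfFinset U hU) A hA =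
      PMF.uniformOfFinset (visiblePart U A) (visiblePart_nonempty U hA) := by
  classical
  have hiff : (∃ i ∈ (A : Set (Fin n)), i ∈ (PMF.uniformOfFinset U hU).support) ↔
      (U ∩ A).Nonempty := by
    simp [Finset.Nonempty, and_comm]
  have hU0 : (#U : ENNReal) ≠ 0 := by exact_mod_cast hU.card_pos.ne'
  rw [condSample]
  split_ifs with h
  · have h' := hiff.1 h
    have hne : (#(U ∩ A) : ENNReal) ≠ 0 := by exact_mod_cast h'.card_pos.ne'
    have hind : ∀ x, (A : Set (Fin n)).indicator (PMF.uniformOfFinset U hU) x =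
        if x ∈ U ∩ A then (#U : ENNReal)⁻¹ else 0 := by
      intro x
      by_cases h1 : x ∈ A <;> by_cases h2 : x ∈ U <;> simp [Set.indicator, h1, h2]
    ext x
    rw [PMF.filter_apply, tsum_fintype]
    simp_rw [hind]
    rw [sum_ite_mem, univ_inter, sum_const, nsmul_eq_mul, PMF.uniformOfFinset_apply, visiblePart,
      if_pos h']
    split_ifs with hx
    · rw [ENNReal.mul_inv (Or.inl hne) (Or.inl (ENNReal.natCast_ne_top _)), inv_inv, mul_comm,
        mul_assoc, ENNReal.mul_inv_cancel hU0 (ENNReal.natCast_ne_top _), mul_one]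
    · rw [zero_mul]
  · congr 1
    rw [visiblePart, if_neg fun h' => h (hiff.2 h')]

/-- The probability of a decision based on a fixed list of condition sets. -/
theorem toReal_map_condSamples {n : ℕ} (μ : PMF (Fin n))
    (As : List {A : Finset (Fin n) // A.Nonempty}) (d : List (Fin n) → Bool) (b : Bool) :
    ((condSamples μ As).map d b).toReal =
      ∑ j : Fin As.length → Fin n, (if d (List.ofFn j) = b then 1 else 0) *
        ∏ i, (condSample μ (As.get i).1 (As.get i).2 (j i)).toReal := by
  induction As generalizing d with
  | nil =>
    rw [condSamples, PMF.pure_map, PMF.pure_apply]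
    simp only [List.length_nil, univ_unique, sum_singleton, univ_eq_empty, prod_empty, mul_one,
      List.ofFn_zero, eq_comm]
    split_ifs <;> simp
  | cons A As ih =>
    rw [condSamples, PMF.map_bind, PMF.bind_apply, tsum_fintype,
      ENNReal.toReal_sum fun _ _ => ENNReal.mul_ne_top (PMF.apply_ne_top _ _) (PMF.apply_ne_top _ _)]
    simp_rw [PMF.map_comp, ENNReal.toReal_mul, ih]
    refine Eq.trans ?_ (Fintype.sum_equiv (Fin.consEquiv fun _ : Fin (As.length + 1) => Fin n)
      (fun p : Fin n × (Fin As.length → Fin n) => (if d (p.1 :: List.ofFn p.2) = b then 1 else 0) *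
        ((condSample μ A.1 A.2 p.1).toReal *
          ∏ i, (condSample μ (As.get i).1 (As.get i).2 (p.2 i)).toReal)) _ ?_)
    · rw [Fintype.sum_prod_type]
      refine sum_congr rfl fun x _ => ?_
      rw [mul_sum]
      refine sum_congr rfl fun j _ => ?_
      simp only [Function.comp_apply]
      ring
    · rintro ⟨x, j⟩
      simp only [Fin.consEquiv_apply, List.length_cons, Fin.prod_univ_succ, Fin.cons_zero,
        Fin.cons_succ]
      rw [show List.ofFn (n := (A :: As).length) ((Fin.consEquiv fun _ => Fin n) (x, j)) =
        x :: List.ofFn j from List.ofFn_cons x j]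
      rfl

end Laws

/-! ### Counting exponents and the distinguishing bound -/

section Uniblock

/-- The iterated logarithm, rounded down twice. -/
def logLog (n : ℕ) : ℕ := Nat.log 2 (Nat.log 2 n)

/-- The excluded k have a·4^k/n strictly between 4^(-l) and 4^l, a window of ratio 4^(2l), so they
lie within 2l consecutive integers. -/
theorem card_filter_window_le (E : Finset ℕ) (a n l : ℕ) :
    #{k ∈ E | ¬ ((2 ^ (2 * l) : ℝ) * n ≤ a * (2 ^ (2 * k) : ℕ) ∨
      (2 ^ (2 * l) : ℝ) * (a * (2 ^ (2 * k) : ℕ)) ≤ n)} ≤ 2 * l := by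
  set S := {k ∈ E | ¬ ((2 ^ (2 * l) : ℝ) * n ≤ a * (2 ^ (2 * k) : ℕ) ∨
      (2 ^ (2 * l) : ℝ) * (a * (2 ^ (2 * k) : ℕ)) ≤ n)} with hS
  rcases S.eq_empty_or_nonempty with h | h
  · simp [h]
  have hmem : ∀ k ∈ S, a * 2 ^ (2 * k) < 2 ^ (2 * l) * n ∧
      n < 2 ^ (2 * l) * (a * 2 ^ (2 * k)) := by
    intro k hk
    have := (mem_filter.1 hk).2
    push Not at this
    exact ⟨by exact_mod_cast this.1, by exact_mod_cast this.2⟩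
  have hsub : S ⊆ Ico (S.min' h) (S.min' h + 2 * l) := by
    intro k hk
    rw [mem_Ico]
    refine ⟨S.min'_le k hk, ?_⟩
    by_contra! hlt
    have h1 := (hmem k hk).1
    have h2 := (hmem _ (S.min'_mem h)).2
    have h3 : 2 ^ (2 * l) * (2 ^ (2 * l) * (a * 2 ^ (2 * S.min' h))) ≤ a * 2 ^ (2 * k) := by
      calc 2 ^ (2 * l) * (2 ^ (2 * l) * (a * 2 ^ (2 * S.min' h)))
          = a * 2 ^ (2 * (S.min' h + 2 * l)) := by ring
        _ ≤ a * 2 ^ (2 * k) := by gcongr; norm_num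
    have h4 := Nat.mul_le_mul_left (2 ^ (2 * l)) h2.le
    omega
  simpa using card_le_card hsub

theorem natLog_le_logb {n : ℕ} (hn : 0 < n) : (Nat.log 2 n : ℝ) ≤ Real.logb 2 n := by
  rw [Real.le_logb_iff_rpow_le (by norm_num) (by exact_mod_cast hn), Real.rpow_natCast]
  exact_mod_cast Nat.pow_log_le_self 2 hn.ne'

theorem two_pow_logLog_le {n : ℕ} (hn : 16 ≤ n) : (2 : ℝ) ^ logLog n ≤ Real.logb 2 n := by
  refine le_trans ?_ (natLog_le_logb (by omega))
  have h : Nat.log 2 n ≠ 0 := (Nat.log_pos (by norm_num) (by omega)).ne'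
  exact_mod_cast Nat.pow_log_le_self 2 h

/-- The factor 1/4 is simply dropped. Rounding down twice costs nothing because s is an integer. -/
theorem le_logLog {n s : ℕ} (hn : 16 ≤ n)
    (hs : (s : ℝ) ≤ (1 / 4 : ℝ) * Real.logb 2 (Real.logb 2 n)) : s ≤ logLog n := by
  have hL := four_le_logb hn
  have hn0 : (0 : ℝ) < n := by exact_mod_cast (by omega : 0 < n)
  have h1 : (s : ℝ) ≤ Real.logb 2 (Real.logb 2 n) := by
    have : (0 : ℝ) ≤ s := by positivity
    linarith
  rw [Real.le_logb_iff_rpow_le (by norm_num) (by linarith), Real.rpow_natCast] at h1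
  have h2 : ((2 ^ s : ℕ) : ℝ) ≤ Real.logb 2 n := by exact_mod_cast h1
  rw [Real.le_logb_iff_rpow_le (by norm_num) hn0, Real.rpow_natCast] at h2
  have h3 : 2 ^ 2 ^ s ≤ n := by exact_mod_cast h2
  exact Nat.le_log_of_pow_le (by norm_num) (Nat.le_log_of_pow_le (by norm_num) h3)

theorem two_pow_logLog_le_block {n k : ℕ} (hn : 16 ≤ n) (hk : k ∈ uniblockExponents n) :
    (2 : ℝ) ^ logLog n ≤ 4 * (2 ^ (2 * k) : ℕ) := by
  have h1 := (Nat.ceil_le.1 (mem_Icc.1 hk).1)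
  have h2 := two_pow_logLog_le hn
  have h3 : ((2 * k : ℕ) : ℝ) ≤ (2 ^ (2 * k) : ℕ) := by exact_mod_cast Nat.lt_two_pow_self.le
  push_cast at h3 ⊢
  linarith

theorem two_pow_logLog_le_card {n : ℕ} (hn : 16 ≤ n) :
    (2 : ℝ) ^ logLog n ≤ 8 * #(uniblockExponents n) := by
  have hL := four_le_logb hn
  have h1 : (1 : ℝ) ≤ #(uniblockExponents n) := by
    exact_mod_cast (uniblockExponents_nonempty hn).card_pos
  have h2 := two_pow_logLog_le hn
  have h3 := Nat.lt_floor_add_one ((3 / 8 : ℝ) * Real.logb 2 n)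
  have h4 := Nat.ceil_lt_add_one (show (0 : ℝ) ≤ 1 / 8 * Real.logb 2 n by linarith)
  have h5 : (⌊(3 / 8 : ℝ) * Real.logb 2 n⌋₊ : ℝ) + 1 ≤
      #(uniblockExponents n) + ⌈(1 / 8 : ℝ) * Real.logb 2 n⌉₊ := by
    rw [uniblockExponents, Nat.card_Icc]
    exact_mod_cast (by omega)
  -- The count exceeds (log n)/4 - 1; the constant 8 absorbs the -1, as the count is at least 1.
  linarith

theorem two_mul_two_pow_le {n k : ℕ} (hn : 16 ≤ n) (hk : k ∈ uniblockExponents n) :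
    2 * 2 ^ (2 * k) ≤ n := by
  have hL := four_le_logb hn
  have hn0 : (0 : ℝ) < n := by exact_mod_cast (by omega : 0 < n)
  have h1 := (mem_Icc.1 hk).2
  rw [Nat.le_floor_iff (by linarith)] at h1
  have h2 : ((2 * k + 1 : ℕ) : ℝ) ≤ Real.logb 2 n := by push_cast; linarith
  rw [Real.le_logb_iff_rpow_le (by norm_num) hn0, Real.rpow_natCast] at h2
  have h3 : 2 ^ (2 * k + 1) ≤ n := by exact_mod_cast h2
  rwa [pow_succ, mul_comm] at h3

theorem tendsto_logLog : Filter.Tendsto logLog Filter.atTop Filter.atTop := by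
  have h : Filter.Tendsto (Nat.log 2) Filter.atTop Filter.atTop :=
    Filter.tendsto_atTop_atTop.2 fun b =>
      ⟨2 ^ b, fun _ ha => Nat.le_log_of_pow_le (by norm_num) ha⟩
  exact h.comp h

/-- The bound on the advantage in distinguishing the uniform distribution from the even uniblock
distribution. -/
def advantageBound (n : ℕ) : ℝ := 24 * ((logLog n : ℝ) ^ 2 / 2 ^ logLog n)

theorem advantageBound_nonneg (n : ℕ) : 0 ≤ advantageBound n := by
  unfold advantageBound; positivity

theorem tendsto_advantageBound : Filter.Tendsto advantageBound Filter.atTop (nhds 0) := by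
  have h := ((tendsto_pow_const_div_const_pow_of_one_lt 2 (by norm_num : (1 : ℝ) < 2)).comp
    tendsto_logLog).const_mul 24
  rw [mul_zero] at h
  exact h

theorem exists_uniformDist_eq {n : ℕ} (hn : 0 < n) :
    ∃ h : (univ : Finset (Fin n)).Nonempty, uniformDist n hn = PMF.uniformOfFinset univ h :=
  ⟨_, rfl⟩

theorem tvDist_uniformOfFinset_ge {n : ℕ} (hn : 0 < n) {U : Finset (Fin n)} (hU : U.Nonempty) :
    1 - (#U : ℝ) / n ≤ tvDist (PMF.uniformOfFinset U hU) (uniformDist n hn) := by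
  have hn' : (0 : ℝ) < n := by exact_mod_cast hn
  have h : ∀ i : Fin n, flatWeight U i + flatWeight univ i - 2 * (if i ∈ U then (1 / n : ℝ) else 0) ≤
      |flatWeight U i - flatWeight univ i| := by
    intro i
    by_cases hi : i ∈ U
    · refine le_trans (le_of_eq ?_) (le_abs_self _)
      simp [flatWeight, hi]; ring
    · refine le_trans (le_of_eq ?_) (neg_le_abs _)
      simp [flatWeight, hi]
  have hsum := sum_le_sum fun i (_ : i ∈ univ) => h i
  rw [sum_sub_distrib, sum_add_distrib, sum_flatWeight hU,
    sum_flatWeight ⟨⟨0, hn⟩, mem_univ _⟩, ← mul_sum, sum_ite_mem, univ_inter, sum_const,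
    nsmul_eq_mul, mul_one_div] at hsum
  obtain ⟨h0, e⟩ := exists_uniformDist_eq hn
  rw [e]
  simp only [tvDist, toReal_uniformOfFinset_apply]
  linarith

theorem isFar_of_mem_support_evenUniblock {n : ℕ} (hn : 16 ≤ n) {μ : PMF (Fin n)}
    (hμ : μ ∈ (evenUniblock n hn).support) : IsFar (1 / 2) μ (uniformity n) := by
  rintro ν ⟨hn0, rfl⟩
  simp only [evenUniblock, PMF.mem_support_bind_iff, PMF.mem_support_map_iff] at hμ
  obtain ⟨k, -, U, -, rfl⟩ := hμ
  refine le_trans ?_ (tvDist_uniformOfFinset_ge hn0 _)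
  have hn' : (0 : ℝ) < n := by exact_mod_cast hn0
  have hcard : #U.1 = 2 ^ (2 * k.1) := (mem_powersetCard.1 U.2).2
  have h : (2 * #U.1 : ℝ) ≤ n := by rw [hcard]; exact_mod_cast two_mul_two_pow_le hn k.2
  have : (#U.1 : ℝ) / n ≤ 1 / 2 := by rw [div_le_iff₀ hn']; linarith
  linarith

theorem toReal_map_condSamples_uniformOfFinset {n : ℕ} {U : Finset (Fin n)} (hU : U.Nonempty)
    (As : List {A : Finset (Fin n) // A.Nonempty}) (d : List (Fin n) → Bool) (b : Bool) :
    ((condSamples (PMF.uniformOfFinset U hU) As).map d b).toReal =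
      ∑ j : Fin As.length → Fin n, (if d (List.ofFn j) = b then 1 else 0) *
        ∏ i, flatWeight (visiblePart U (As.get i).1) (j i) := by
  rw [toReal_map_condSamples]
  simp only [condSample_uniformOfFinset, toReal_uniformOfFinset_apply]

/-- The probability of an event when the input is drawn from the even uniblock distribution. -/
theorem toReal_evenUniblock_bind {n : ℕ} (hn : 16 ≤ n) (F : PMF (Fin n) → PMF Bool) (b : Bool)
    (f : Finset (Fin n) → ℝ)
    (hf : ∀ U (hU : U.Nonempty), (F (PMF.uniformOfFinset U hU) b).toReal = f U) :
    ((evenUniblock n hn).bind F b).toReal =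
      (∑ k ∈ uniblockExponents n,
        (∑ U ∈ evenBlocks n k, f U) / n.choose (2 ^ (2 * k))) / #(uniblockExponents n) := by
  rw [evenUniblock, PMF.bind_bind, toReal_uniformOfFinset_bind, card_attach]
  congr 1
  rw [← sum_attach (uniblockExponents n)]
  refine sum_congr rfl fun k _ => ?_
  rw [PMF.bind_map, toReal_uniformOfFinset_bind, card_attach]
  simp only [Function.comp_apply, hf]
  rw [sum_attach (evenBlocks n k.1) f, evenBlocks, card_powersetCard, card_univ, Fintype.card_fin]

theorem toReal_map_condSamples_uniformDist_le {n : ℕ} (hn0 : 0 < n) (hn : 16 ≤ n)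
    (As : List {A : Finset (Fin n) // A.Nonempty}) (hAs : As.length ≤ logLog n)
    (d : List (Fin n) → Bool) (b : Bool) :
    ((condSamples (uniformDist n hn0) As).map d b).toReal ≤
      (((evenUniblock n hn).bind fun μ => (condSamples μ As).map d) b).toReal +
        advantageBound n := by
  obtain ⟨h0, e⟩ := exists_uniformDist_eq hn0
  rw [toReal_evenUniblock_bind hn _ b _
    fun U hU => toReal_map_condSamples_uniformOfFinset hU As d b, e,
    toReal_map_condSamples_uniformOfFinset]
  set A : Fin As.length → Finset (Fin n) := fun i => (As.get i).1 with hAdef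
  have hA : ∀ i, (A i).Nonempty := fun i => (As.get i).2
  set g : (Fin As.length → Fin n) → ℝ := fun j => if d (List.ofFn j) = b then 1 else 0 with hg
  have hg0 : ∀ j, 0 ≤ g j := fun j => by simp only [hg]; split_ifs <;> norm_num
  have hg1 : ∀ j, g j ≤ 1 := fun j => by simp only [hg]; split_ifs <;> norm_num
  have huniv : ∀ i, visiblePart univ (A i) = A i := fun i => by
    rw [visiblePart, univ_inter, if_pos (hA i)]
  set Φ : ℕ → ℝ := fun k => (∑ U ∈ evenBlocks n k, ∑ j, g j *
    ∏ i, flatWeight (visiblePart U (A i)) (j i)) / n.choose (2 ^ (2 * k)) with hΦ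
  change ∑ j, g j * ∏ i, flatWeight (visiblePart univ (A i)) (j i) ≤
    (∑ k ∈ uniblockExponents n, Φ k) / #(uniblockExponents n) + _
  simp_rw [huniv]
  set q := ∑ j, g j * ∏ i, flatWeight (A i) (j i) with hq
  have hprod0 : ∀ (S : Fin As.length → Finset (Fin n)) (j : Fin As.length → Fin n),
      0 ≤ ∏ i, flatWeight (S i) (j i) := fun S j => prod_nonneg fun i _ => flatWeight_nonneg _ _
  have hq1 : q ≤ 1 := by
    rw [← sum_prod_flatWeight hA]
    exact sum_le_sum fun j _ => mul_le_of_le_one_left (hprod0 _ _) (hg1 j)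
  have hΦ0 : ∀ k, 0 ≤ Φ k := fun k => div_nonneg
    (sum_nonneg fun U _ => sum_nonneg fun j _ => mul_nonneg (hg0 j) (hprod0 _ _)) (by positivity)
  set l := logLog n with hl
  set bad : ℕ → Prop := fun k => ∃ i, ¬ ((2 ^ (2 * l) : ℝ) * n ≤ #(A i) * (2 ^ (2 * k) : ℕ) ∨
      (2 ^ (2 * l) : ℝ) * (#(A i) * (2 ^ (2 * k) : ℕ)) ≤ n) with hbad
  classical
  set E := uniblockExponents n with hE
  have hcardbad : (#{k ∈ E | bad k} : ℝ) ≤ 2 * l ^ 2 := by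
    have h1 : #{k ∈ E | bad k} ≤ As.length * (2 * l) := by
      calc #{k ∈ E | bad k} ≤ #(univ.biUnion fun i : Fin As.length =>
            {k ∈ E | ¬ ((2 ^ (2 * l) : ℝ) * n ≤ #(A i) * (2 ^ (2 * k) : ℕ) ∨
              (2 ^ (2 * l) : ℝ) * (#(A i) * (2 ^ (2 * k) : ℕ)) ≤ n)}) := by
            refine card_le_card fun k hk => ?_
            obtain ⟨hkE, i, hi⟩ := mem_filter.1 hk
            exact mem_biUnion.2 ⟨i, mem_univ _, mem_filter.2 ⟨hkE, hi⟩⟩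
        _ ≤ ∑ _i : Fin As.length, 2 * l :=
            card_biUnion_le.trans (sum_le_sum fun i _ => card_filter_window_le E _ n l)
        _ = As.length * (2 * l) := by simp
    have h2 : #{k ∈ E | bad k} ≤ 2 * l ^ 2 :=
      h1.trans ((Nat.mul_le_mul_right _ hAs).trans_eq (by ring))
    exact_mod_cast h2
  set r : ℝ := (l : ℝ) ^ 2 / 2 ^ l with hr
  have hr0 : 0 ≤ r := by positivity
  -- A bad exponent costs at most q ≤ 1. A good one costs 4r from the block size, at least 2^l/4,
  -- and 4r from K = 4^l ≥ 2^l.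
  have hstep : ∀ k ∈ E, q ≤ Φ k + 8 * r + (if bad k then 1 else 0) := by
    intro k hk
    split_ifs with hb
    · linarith [hΦ0 k]
    · have hdich : ∀ i, (2 ^ (2 * l) : ℝ) * Fintype.card (Fin n) ≤ #(A i) * (2 ^ (2 * k) : ℕ) ∨
          (2 ^ (2 * l) : ℝ) * (#(A i) * (2 ^ (2 * k) : ℕ)) ≤ Fintype.card (Fin n) := by
        intro i
        rw [Fintype.card_fin]
        by_contra h
        exact hb ⟨i, h⟩
      have hkn : 2 ^ (2 * k) ≤ Fintype.card (Fin n) := by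
        rw [Fintype.card_fin]; linarith [two_mul_two_pow_le hn hk]
      have key := sum_flatWeight_le_average (by positivity) hkn
        (one_le_pow₀ (by norm_num : (1 : ℝ) ≤ 2)) hA hdich hg0 hg1
      rw [Fintype.card_fin, Fintype.card_fin] at key
      have ht : (As.length : ℝ) ≤ l := by exact_mod_cast hAs
      have h1 : (As.length : ℝ) ^ 2 / (2 ^ (2 * k) : ℕ) ≤ 4 * r := by
        have := two_pow_logLog_le_block hn hk
        rw [hr, mul_div_assoc', div_le_div_iff₀ (by positivity) (by positivity)]
        calc (As.length : ℝ) ^ 2 * 2 ^ l ≤ (l : ℝ) ^ 2 * (4 * (2 ^ (2 * k) : ℕ)) := by gcongr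
          _ = _ := by ring
      have h2 : 4 * (As.length : ℝ) ^ 2 / 2 ^ (2 * l) ≤ 4 * r := by
        rw [hr, mul_div_assoc]
        gcongr
        · norm_num
        · omega
      have h3 : q ≤ Φ k + _ := key
      linarith
  have hE0 : (0 : ℝ) < #E := by exact_mod_cast (uniblockExponents_nonempty hn).card_pos
  have hsum := sum_le_sum hstep
  rw [sum_add_distrib, sum_add_distrib, sum_const, sum_const, sum_boole, nsmul_eq_mul,
    nsmul_eq_mul] at hsum
  -- The 2l² bad exponents thus contribute at most 16r·|E|; with the 8r per exponent this makes the
  -- constant 24.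
  have hEr : (l : ℝ) ^ 2 ≤ 8 * #E * r := by
    have h1 := two_pow_logLog_le_card hn
    have h2 : (l : ℝ) ^ 2 = 2 ^ l * r := by rw [hr]; field_simp
    rw [h2]
    gcongr
  have hadv : advantageBound n = 24 * r := rfl
  rw [hadv, ← sub_le_iff_le_add, le_div_iff₀ hE0]
  linarith

theorem NonAdaptiveAlgorithm.abs_run_uniformDist_sub_le {n s : ℕ} (hn0 : 0 < n) (hn : 16 ≤ n)
    (T : NonAdaptiveAlgorithm n)
    (hs : (s : ℝ) ≤ (1 / 4 : ℝ) * Real.logb 2 (Real.logb 2 n)) (hT : T.UsesAtMost s) :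
    |(T.run (uniformDist n hn0) true).toReal -
      (((evenUniblock n hn).bind T.run) true).toReal| ≤ advantageBound n := by
  have hle : ∀ b, (T.run (uniformDist n hn0) b).toReal ≤
      (((evenUniblock n hn).bind T.run) b).toReal + advantageBound n := by
    intro b
    -- Coins and input are independent, so the coins can be drawn first and the condition sets
    -- treated as fixed.
    have hcomm : (evenUniblock n hn).bind T.run = T.coinLaw.bind fun c =>
        (evenUniblock n hn).bind fun μ => (condSamples μ (T.sets c)).map (T.decision c) :=
      PMF.bind_comm _ _ _
    rw [hcomm]
    exact toReal_bind_apply_le_add _ (advantageBound_nonneg n) fun c hc =>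
      toReal_map_condSamples_uniformDist_le hn0 hn _ ((hT c hc).trans (le_logLog hn hs)) _ b
  have h1 := hle true
  have h2 := hle false
  have h3 := toReal_true_add_false (T.run (uniformDist n hn0))
  have h4 := toReal_true_add_false ((evenUniblock n hn).bind T.run)
  rw [abs_le]
  constructor <;> linarith

end Uniblock

end CondSampling

end

theorem mainTheorem10 :
    (∀ δ : ℝ, 0 < δ → δ < 1 / 2 →
      ∃ N : ℕ, ∀ n : ℕ, N ≤ n →
        ∀ (s : ℕ) (T : CondSampling.NonAdaptiveAlgorithm n),
          CondSampling.IsTester T (CondSampling.uniformity n) (1 / 2) δ s →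
            (1 / 4 : ℝ) * Real.logb 2 (Real.logb 2 n) < s) ∧
    (∃ ρ : ℕ → ℝ, Filter.Tendsto ρ Filter.atTop (nhds 0) ∧
      ∀ (n : ℕ) (hn : 16 ≤ n),
        (∀ μ ∈ (CondSampling.evenUniblock n hn).support,
          CondSampling.IsFar (1 / 2) μ (CondSampling.uniformity n)) ∧
        ∀ (s : ℕ) (T : CondSampling.NonAdaptiveAlgorithm n),
          (s : ℝ) ≤ (1 / 4 : ℝ) * Real.logb 2 (Real.logb 2 n) → T.UsesAtMost s →
            |(T.run (CondSampling.uniformDist n (by omega)) true).toReal -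
              (((CondSampling.evenUniblock n hn).bind T.run) true).toReal| ≤ ρ n) := by
  refine ⟨fun δ hδ0 hδ => ?_, CondSampling.advantageBound, CondSampling.tendsto_advantageBound,
    fun n hn => ⟨fun μ hμ => CondSampling.isFar_of_mem_support_evenUniblock hn hμ,
      fun s T hs hT => T.abs_run_uniformDist_sub_le _ hn hs hT⟩⟩
  -- A tester accepts the uniform law with probability at least 1 - δ and a random block with
  -- probability at most δ, so its advantage is at least 1 - 2δ > 0.
  obtain ⟨N, hN⟩ := Filter.eventually_atTop.1
    (CondSampling.tendsto_advantageBound.eventually_lt_const (by linarith : 0 < 1 - 2 * δ))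
  refine ⟨max N 16, fun n hn s T hT => ?_⟩
  by_contra! hs
  have hn16 : 16 ≤ n := (le_max_right _ _).trans hn
  have hρ := hN n ((le_max_left _ _).trans hn)
  have h1 := T.abs_run_uniformDist_sub_le (by omega) hn16 hs hT.usesAtMost
  have h2 := hT.accepts _ ⟨by omega, rfl⟩
  have h3 : (((CondSampling.evenUniblock n hn16).bind T.run) true).toReal ≤ δ := by
    refine CondSampling.toReal_bind_apply_le _ hδ0.le fun μ hμ => ?_
    have h4 := hT.rejects μ (CondSampling.isFar_of_mem_support_evenUniblock hn16 hμ)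
    have h5 := CondSampling.toReal_true_add_false (T.run μ)
    linarith
  have h6 := (abs_le.1 h1).2
  linarith
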